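/- Let $1\le p,q<\infty$, $0\le\theta,\nu<1$ and $1\le r<\infty$ satisfy $\frac1r+\frac{1-\theta}{p}+\frac{1-\nu}{q}=1$ (so that $r>1$), and let $r'$ be the conjugate exponent, $\frac1r+\frac1{r'}=1$. Let $X$ be a metric space with a base point $x_0$, let $F$ be a Banach space over $\mathbb K\in\{\mathbb R,\mathbb C\}$, and let $T:X\to F$ be a Lipschitz map. Notation. $B_{X^{\#}}$ is the set of all $1$-Lipschitz functions $f:X\to\mathbb R$ with $f(x_0)=0$, with the topology of pointwise convergence. For a Banach space $E$, $B_{E^*}$ is the closed unit ball of $E^*$ with the weak-$*$ topology. A bounded linear operator $R:E\to H$ between Banach spaces is $q$-summing if there is $C\ge0$ with $$\Big(\sum_{j=1}^m\|Ra_j\|^q\Big)^{1/q}\le C\sup_{\xi\in B_{E^*}}\Big(\sum_{j=1}^m|\langle a_j,\xi\rangle|^q\Big)^{1/q}$$ for all finite sequences $(a_j)_{j=1}^m$ in $E$; $\pi_q(R)$ is the infimum of such $C$. A Lipschitz map $S:X\to G$ into a Banach space $G$ is Lipschitz $p$-summing if there is $C\ge 0$ with $$\Big(\sum_{j=1}^m\lambda_j^p\|Sx_j'-Sx_j''\|^p\Big)^{1/p}\le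 C\sup_{f\in B_{X^\#}}\Big(\sum_{j=1}^m\lambda_j^p|f(x_j')-f(x_j'')|^p\Big)^{1/p}$$ for all $m$, $x_j',x_j''\in X$ and $\lambda_j\ge0$; $\pi_p^L(S)$ is the infimum of such $C$. The map $T$ is called Lipschitz $(p,\theta,q,\nu)$-dominated if there are Banach spaces $G,H$, a Lipschitz $p$-summing map $S:X\to G$, a $q$-summing operator $R:F^*\to H$ and a constant $C>0$ such that $$|\langle Tx'-Tx'',b^*\rangle|\le C\,d(x',x'')^{\theta}\,\|Sx'-Sx''\|^{1-\theta}\,\|b^*\|^{\nu}\,\|Rb^*\|^{1-\nu}\qquad(x',x''\in X,\ b^*\in F^*),$$ and $D^L_{(p,\theta,q,\nu)}(T)$ is the infimum of $C\,\pi_p^L(S)^{1-\theta}\,\pi_q(R)^{1-\nu}$ over all such $G,H,S,R,C$. Theorem. The following conditions are equivalent. (1) $T$ is Lipschitz $(p,\theta,q,\nu)$-dominated. (2) There are a constant $C\ge0$ and regular Borel probability measures $\mu$ on $B_{X^\#}$ and $\tau$ on $B_{F^{**}}$ such that for all $x',x''\in X$ and $b^*\in F^*$ $$|\langle Tx'-Tx'',b^*\rangle|\le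 C\Big[\int_{B_{X^\#}}\big(|f(x')-f(x'')|^{1-\theta}d(x',x'')^{\theta}\big)^{\frac p{1-\theta}}d\mu(f)\Big]^{\frac{1-\theta}p}\Big[\int_{B_{F^{**}}}\big(|\langle b^*,b^{**}\rangle|^{1-\nu}\|b^*\|^{\nu}\big)^{\frac q{1-\nu}}d\tau(b^{**})\Big]^{\frac{1-\nu}q}.$$ (3) There is a constant $C\ge0$ such that for all $m\in\mathbb N$, $x_j',x_j''\in X$, $\sigma_j\in\mathbb R$ and $b_j^*\in F^*$ $(1\le j\le m)$ $$\Big(\sum_{j=1}^m|\sigma_j\langle Tx_j'-Tx_j'',b_j^*\rangle|^{r'}\Big)^{\frac1{r'}}\le C\sup_{f\in B_{X^\#}}\Big[\sum_{j=1}^m\big(|\sigma_j||f(x_j')-f(x_j'')|^{1-\theta}d(x_j',x_j'')^\theta\big)^{\frac p{1-\theta}}\Big]^{\frac{1-\theta}p}\sup_{b^{**}\in B_{F^{**}}}\Big[\sum_{j=1}^m\big(|\langle b_j^*,b^{**}\rangle|^{1-\nu}\|b_j^*\|^\nu\big)^{\frac q{1-\nu}}\Big]^{\frac{1-\nu}q}.$$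 In this case $D^L_{(p,\theta,q,\nu)}(T)$ equals the infimum of the constants $C$ for which (2) holds (for some $\mu,\tau$), and also the infimum of the constants $C$ for which (3) holds. -/

import Mathlib

open MeasureTheory

noncomputable section

universe u v

/-- The closed unit ball `B_{X^#}` of the Lipschitz dual of the pointed metric space `(X, x₀)`:
real functions on `X` that vanish at the base point and have Lipschitz constant at most `1`. -/
def LipUnitBall {X : Type u} [MetricSpace X] (x₀ : X) : Type u :=
  {f : X → ℝ // LipschitzWith 1 f ∧ f x₀ = 0}

namespace LipUnitBall

variable {X : Type u} [MetricSpace X] {x₀ : X}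

instance : CoeFun (LipUnitBall x₀) (fun _ => X → ℝ) := ⟨fun f => f.1⟩

/-- The topology of pointwise convergence on `X`; it is the weak-* topology of the ball, and makes
it a compact Hausdorff space. -/
instance : TopologicalSpace (LipUnitBall x₀) :=
  TopologicalSpace.induced (fun f : LipUnitBall x₀ => (f : X → ℝ)) inferInstance

/-- The Borel σ-algebra of that topology (in general larger than the product σ-algebra). -/
instance : MeasurableSpace (LipUnitBall x₀) := borel _

instance : BorelSpace (LipUnitBall x₀) := ⟨rfl⟩

end LipUnitBall

/-- The closed unit ball `B_{E^*}` of the dual of a normed space `E`. -/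
def DualUnitBall (𝕜 : Type) [RCLike 𝕜] (E : Type v) [NormedAddCommGroup E] [NormedSpace 𝕜 E] :=
  {φ : WeakDual 𝕜 E // ‖WeakDual.toStrongDual φ‖ ≤ 1}

namespace DualUnitBall

variable {𝕜 : Type} [RCLike 𝕜] {E : Type v} [NormedAddCommGroup E] [NormedSpace 𝕜 E]

instance : CoeFun (DualUnitBall 𝕜 E) (fun _ => E → 𝕜) := ⟨fun φ => φ.1⟩

/-- The weak-* topology. -/
instance : TopologicalSpace (DualUnitBall 𝕜 E) :=
  TopologicalSpace.induced (fun φ : DualUnitBall 𝕜 E => (φ.1 : WeakDual 𝕜 E)) inferInstance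

/-- The Borel σ-algebra of the weak-* topology. -/
instance : MeasurableSpace (DualUnitBall 𝕜 E) := borel _

instance : BorelSpace (DualUnitBall 𝕜 E) := ⟨rfl⟩

end DualUnitBall

/-! ### Norms of finite sequences -/

/-- `‖a | ℓ_s(E)‖`. -/
def ellNorm {E : Type*} [NormedAddCommGroup E] (s : ℝ) {m : ℕ} (a : Fin m → E) : ℝ :=
  (∑ j, ‖a j‖ ^ s) ^ (1 / s)

/-- `‖a | ℓ_s^w(E)‖`. -/
def weakEllNorm (𝕜 : Type) [RCLike 𝕜] {E : Type v} [NormedAddCommGroup E] [NormedSpace 𝕜 E]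
    (s : ℝ) {m : ℕ} (a : Fin m → E) : ℝ :=
  ⨆ ξ : DualUnitBall 𝕜 E, (∑ j, ‖ξ (a j)‖ ^ s) ^ (1 / s)

/-- `‖(σ, x', x'') | ℓ_s(ℝ × Y × Y)‖`. -/
def lipEllNorm {Y : Type*} [MetricSpace Y] (s : ℝ) {m : ℕ} (σ : Fin m → ℝ) (x' x'' : Fin m → Y) :
    ℝ :=
  (∑ j, |σ j| ^ s * dist (x' j) (x'' j) ^ s) ^ (1 / s)

/-- `‖(σ, x', x'') | ℓ_s^{L,w}(ℝ × X × X)‖`. -/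
def lipWeakEllNorm {X : Type u} [MetricSpace X] (x₀ : X) (s : ℝ) {m : ℕ} (σ : Fin m → ℝ)
    (x' x'' : Fin m → X) : ℝ :=
  ⨆ f : LipUnitBall x₀, (∑ j, |σ j| ^ s * |f (x' j) - f (x'' j)| ^ s) ^ (1 / s)

/-- `‖a | δ_{p,θ}(E)‖`. -/
def deltaNorm (𝕜 : Type) [RCLike 𝕜] {E : Type v} [NormedAddCommGroup E] [NormedSpace 𝕜 E]
    (p θ : ℝ) {m : ℕ} (a : Fin m → E) : ℝ :=
  ⨆ ξ : DualUnitBall 𝕜 E,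
    (∑ j, (‖ξ (a j)‖ ^ (1 - θ) * ‖a j‖ ^ θ) ^ (p / (1 - θ))) ^ ((1 - θ) / p)

/-- `‖(σ, x', x'') | δ_{p,θ}^L(ℝ × X × X)‖`. -/
def lipDeltaNorm {X : Type u} [MetricSpace X] (x₀ : X) (p θ : ℝ) {m : ℕ} (σ : Fin m → ℝ)
    (x' x'' : Fin m → X) : ℝ :=
  ⨆ f : LipUnitBall x₀,
    (∑ j, (|σ j| * |f (x' j) - f (x'' j)| ^ (1 - θ) * dist (x' j) (x'' j) ^ θ) ^ (p / (1 - θ)))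
      ^ ((1 - θ) / p)

/-! ### Summing operators -/

/-- `C` is a constant in the inequality that defines `p`-summing operators. -/
def IsSummingConst (𝕜 : Type) [RCLike 𝕜] {E H : Type*} [NormedAddCommGroup E] [NormedSpace 𝕜 E]
    [NormedAddCommGroup H] [NormedSpace 𝕜 H] (p : ℝ) (R : E →L[𝕜] H) (C : ℝ) : Prop :=
  0 ≤ C ∧ ∀ (m : ℕ) (a : Fin m → E), ellNorm p (fun j => R (a j)) ≤ C * weakEllNorm 𝕜 p a

/-- `R ∈ Π_p(E, H)`. -/
def IsSumming (𝕜 : Type) [RCLike 𝕜] {E H : Type*} [NormedAddCommGroup E] [NormedSpace 𝕜 E]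
    [NormedAddCommGroup H] [NormedSpace 𝕜 H] (p : ℝ) (R : E →L[𝕜] H) : Prop :=
  ∃ C, IsSummingConst 𝕜 p R C

/-- The `p`-summing norm `π_p(R)`. -/
def summingNorm (𝕜 : Type) [RCLike 𝕜] {E H : Type*} [NormedAddCommGroup E] [NormedSpace 𝕜 E]
    [NormedAddCommGroup H] [NormedSpace 𝕜 H] (p : ℝ) (R : E →L[𝕜] H) : ℝ :=
  sInf {C | IsSummingConst 𝕜 p R C}

/-- `C` is a constant in the inequality that defines Lipschitz `p`-summing maps. -/
def IsLipSummingConst {X : Type u} [MetricSpace X] (x₀ : X) {Y : Type*} [MetricSpace Y] (p : ℝ)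
    (S : X → Y) (C : ℝ) : Prop :=
  0 ≤ C ∧ ∀ (m : ℕ) (lam : Fin m → ℝ) (x' x'' : Fin m → X), (∀ j, 0 ≤ lam j) →
    lipEllNorm p lam (fun j => S (x' j)) (fun j => S (x'' j)) ≤ C * lipWeakEllNorm x₀ p lam x' x''

/-- `S ∈ Π_p^L(X, Y)`. -/
def IsLipSumming {X : Type u} [MetricSpace X] (x₀ : X) {Y : Type*} [MetricSpace Y] (p : ℝ)
    (S : X → Y) : Prop :=
  (∃ K, LipschitzWith K S) ∧ ∃ C, IsLipSummingConst x₀ p S C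

/-- The Lipschitz `p`-summing norm `π_p^L(S)`. -/
def lipSummingNorm {X : Type u} [MetricSpace X] (x₀ : X) {Y : Type*} [MetricSpace Y] (p : ℝ)
    (S : X → Y) : ℝ :=
  sInf {C | IsLipSummingConst x₀ p S C}

/-! ### Lipschitz `(p, θ, q, ν)`-dominated operators -/

section Dominated

variable (𝕜 : Type) [RCLike 𝕜] {X : Type u} [MetricSpace X] (x₀ : X)
  {F : Type v} [NormedAddCommGroup F] [NormedSpace 𝕜 F]

/-- `S`, `R` and `C` are admissible in the definition of a Lipschitz `(p, θ, q, ν)`-dominated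
operator `T`. -/
def IsAdmissible (p θ q ν : ℝ) (T : X → F)
    {G H : Type*} [NormedAddCommGroup G] [NormedAddCommGroup H] [NormedSpace 𝕜 H]
    (S : X → G) (R : StrongDual 𝕜 F →L[𝕜] H) (C : ℝ) : Prop :=
  IsLipSumming x₀ p S ∧ IsSumming 𝕜 q R ∧ 0 < C ∧
    ∀ (x' x'' : X) (b : StrongDual 𝕜 F),
      ‖b (T x' - T x'')‖ ≤
        C * dist x' x'' ^ θ * ‖S x' - S x''‖ ^ (1 - θ) * ‖b‖ ^ ν * ‖R b‖ ^ (1 - ν)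

/-- All numbers `C · π_p^L(S)^{1-θ} · π_q(R)^{1-ν}`, for Banach spaces `G`, `H` and admissible
`S : X → G`, `R : F^* → H` and `C`. The universes of `G` and `H` are those of `X` and of `F^*`; this
loses no Banach space, since only the closed linear spans of the ranges of `S` and `R` matter. -/
def dominationValues (p θ q ν : ℝ) (T : X → F) : Set ℝ :=
  {D | ∃ (G : Type u) (_ : NormedAddCommGroup G) (_ : NormedSpace 𝕜 G) (_ : CompleteSpace G)
      (H : Type v) (_ : NormedAddCommGroup H) (_ : NormedSpace 𝕜 H) (_ : CompleteSpace H)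
      (S : X → G) (R : StrongDual 𝕜 F →L[𝕜] H) (C : ℝ),
      IsAdmissible 𝕜 x₀ p θ q ν T S R C ∧
        D = C * lipSummingNorm x₀ p S ^ (1 - θ) * summingNorm 𝕜 q R ^ (1 - ν)}

/-- `T ∈ D_{(p,θ,q,ν)}^L(X, F)`. -/
def IsLipDominated (p θ q ν : ℝ) (T : X → F) : Prop :=
  (∃ K, LipschitzWith K T) ∧
    ∃ (G : Type u) (_ : NormedAddCommGroup G) (_ : NormedSpace 𝕜 G) (_ : CompleteSpace G)
      (H : Type v) (_ : NormedAddCommGroup H) (_ : NormedSpace 𝕜 H) (_ : CompleteSpace H)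
      (S : X → G) (R : StrongDual 𝕜 F →L[𝕜] H) (C : ℝ), IsAdmissible 𝕜 x₀ p θ q ν T S R C

/-- The norm `D_{(p,θ,q,ν)}^L(T)`. -/
def lipDominatedNorm (p θ q ν : ℝ) (T : X → F) : ℝ :=
  sInf (dominationValues 𝕜 x₀ p θ q ν T)

/-- `C ≥ 0` is a constant for which the integral domination holds with some regular Borel
probability measures on `B_{X^#}` and `B_{F^{**}}`. -/
def IsIntegralConst (p θ q ν : ℝ) (T : X → F) (C : ℝ) : Prop :=
  0 ≤ C ∧ ∃ (μ : Measure (LipUnitBall x₀)) (τ : Measure (DualUnitBall 𝕜 (StrongDual 𝕜 F))),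
    IsProbabilityMeasure μ ∧ μ.Regular ∧ IsProbabilityMeasure τ ∧ τ.Regular ∧
    ∀ (x' x'' : X) (b : StrongDual 𝕜 F),
      ‖b (T x' - T x'')‖ ≤
        C * (∫ f, (|f x' - f x''| ^ (1 - θ) * dist x' x'' ^ θ) ^ (p / (1 - θ)) ∂μ) ^ ((1 - θ) / p)
          * (∫ ξ, (‖ξ b‖ ^ (1 - ν) * ‖b‖ ^ ν) ^ (q / (1 - ν)) ∂τ) ^ ((1 - ν) / q)

/-- `C ≥ 0` is a constant for which the summing inequality in `ℓ_s` holds. -/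
def IsMixedSummingConst (p θ q ν s : ℝ) (T : X → F) (C : ℝ) : Prop :=
  0 ≤ C ∧ ∀ (m : ℕ) (σ : Fin m → ℝ) (x' x'' : Fin m → X) (b : Fin m → StrongDual 𝕜 F),
    ellNorm s (fun j => (σ j : 𝕜) * b j (T (x' j) - T (x'' j))) ≤
      C * lipDeltaNorm x₀ p θ σ x' x'' * deltaNorm 𝕜 q ν b

end Dominated

end

/-! ### Positive functionals and domination by integrals -/

/-! Put P = p/(1-θ), Q = q/(1-ν) and s = r', so that 1/s = 1/P + 1/Q. The proof runs through (1) ⇒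
(3) ⇒ (2) ⇒ (1) while tracking constants: the first two implications keep the constant, and the last
loses an arbitrarily small amount, so the three infima agree.

(1) ⇒ (3) is Hölder's inequality. The factors d^θ and ‖b‖^ν are absorbed into the weights of the two
summing inequalities (`IsAdmissible.isMixedSummingConst`).

(3) ⇒ (2) is a Pietsch separation argument (`IsMixedSummingConst.isIntegralConst`). Young's
inequality replaces the product of the two suprema by a sum, so (3) says that certain finite sums of
functions on the product of the two balls are nonpositive somewhere. Hahn–Banach and Riesz–Markov
turn this into an integral inequality; rescaling σ and b independently and optimizing restores the
product.

(2) ⇒ (1) takes for S and R the evaluation maps into L_p(μ) and L_q(τ), which are summing with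
constant 1 (`IsIntegralConst.exists_isAdmissible`). -/

/-- A convex set of continuous functions on a compact space, each of which is nonpositive somewhere,
is sent to the nonpositive reals by a normalized positive functional. -/
theorem exists_positive_functional_nonpos {K : Type*} [TopologicalSpace K] [CompactSpace K]
    {A : Set C(K, ℝ)} (hA : Convex ℝ A) (hne : A.Nonempty)
    (h : ∀ a ∈ A, ∃ x, a x ≤ 0) :
    ∃ l : C(K, ℝ) →ₗ[ℝ] ℝ, (∀ g, 0 ≤ g → 0 ≤ l g) ∧ l 1 = 1 ∧ ∀ a ∈ A, l a ≤ 0 := by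
  obtain ⟨b, hb⟩ := hne
  have : Nonempty K := ⟨(h b hb).choose⟩
  let P : Set C(K, ℝ) := {g | ∀ x, 0 < g x}
  have hPc : Convex ℝ P := by
    intro g hg k hk s t hs ht hst x
    have h1 := hg x
    have h2 := hk x
    simp only [ContinuousMap.add_apply, ContinuousMap.smul_apply, smul_eq_mul]
    rcases hs.eq_or_lt with rfl | hs
    · obtain rfl : t = 1 := by linarith
      simpa using h2
    · have := mul_pos hs h1
      have := mul_nonneg ht h2.le
      linarith
  have hPo : IsOpen P := by
    have := ContinuousMap.isOpen_setOfPred_mapsTo (X := K) (Y := ℝ) isCompact_univ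
      (isOpen_Ioi (a := (0 : ℝ)))
    simpa [P, Set.MapsTo] using this
  have hdisj : Disjoint P A := by
    rw [Set.disjoint_left]
    intro g hg hgA
    obtain ⟨x, hx⟩ := h g hgA
    exact absurd (hg x) (not_lt.2 hx)
  obtain ⟨f, w, hfP, hfA⟩ := geometric_hahn_banach_open hPc hPo hA hdisj
  -- P is a cone on which f stays below w: large multiples force f ≤ 0 on P, and small multiples of
  -- 1 force w ≥ 0.
  have hsmul : ∀ g ∈ P, ∀ c : ℝ, 0 < c → c * f g < w := by
    intro g hg c hc
    have : c • g ∈ P := fun x => by simpa using mul_pos hc (hg x)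
    simpa using hfP _ this
  have hfP' : ∀ g ∈ P, f g ≤ 0 := by
    intro g hg
    by_contra! hpos
    have := hsmul g hg ((|w| + 1) / f g) (by positivity)
    rw [div_mul_cancel₀ _ hpos.ne'] at this
    linarith [le_abs_self w]
  have h1P : (1 : C(K, ℝ)) ∈ P := fun x => by simp
  have hw : 0 ≤ w := by
    by_contra! hneg
    have h1 := hfP' 1 h1P
    have h3 := hsmul 1 h1P (-w / (1 + |f 1|)) (by apply div_pos <;> [linarith; positivity])
    have h4 : -w / (1 + |f 1|) * f 1 ≥ w := by
      rw [div_mul_eq_mul_div, ge_iff_le, le_div_iff₀ (by positivity), abs_of_nonpos h1]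
      nlinarith
    linarith
  have hbd : ∀ g : C(K, ℝ), ∀ c > 0, f g + (‖g‖ + c) * f 1 ≤ 0 := by
    intro g c hc
    have : g + (‖g‖ + c) • (1 : C(K, ℝ)) ∈ P := by
      intro x
      have := g.norm_coe_le_norm x
      rw [Real.norm_eq_abs] at this
      simp only [ContinuousMap.add_apply, ContinuousMap.smul_apply, ContinuousMap.one_apply,
        smul_eq_mul, mul_one]
      linarith [neg_abs_le (g x)]
    simpa using hfP' _ this
  -- If f 1 = 0, then w > 0, while `hbd` gives f b ≤ 0, against w ≤ f b. This is where A must be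
  -- nonempty.
  have hf1 : f 1 < 0 := by
    refine lt_of_le_of_ne (hfP' 1 h1P) fun h0 => ?_
    have h1 := hbd b 1 one_pos
    have h2 := hfA b hb
    have h3 := hfP 1 h1P
    rw [h0] at h1 h3
    linarith
  refine ⟨(f 1)⁻¹ • f.toLinearMap, fun g hg => ?_, ?_, fun a ha => ?_⟩
  -- A nonnegative g may vanish somewhere, so it is first pushed into P by a small constant whose
  -- image under f is -ε.
  · have : f g ≤ 0 := by
      refine le_of_forall_pos_le_add fun ε hε => ?_
      have : g + (ε / (-f 1)) • (1 : C(K, ℝ)) ∈ P := by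
        intro x
        have h1 : 0 ≤ g x := hg x
        have h2 : 0 < ε / (-f 1) := div_pos hε (by linarith)
        simp only [ContinuousMap.add_apply, ContinuousMap.smul_apply, ContinuousMap.one_apply,
          smul_eq_mul, mul_one]
        linarith
      have h2 := hfP' _ this
      simp only [map_add, map_smul, smul_eq_mul] at h2
      have : ε / (-f 1) * f 1 = -ε := by
        rw [div_neg, neg_mul, div_mul_cancel₀ _ hf1.ne]
      linarith
    simpa using mul_nonneg_of_nonpos_of_nonpos (inv_nonpos.2 hf1.le) this
  · simp [hf1.ne]
  · simpa using mul_nonpos_of_nonpos_of_nonneg (inv_nonpos.2 hf1.le) (hw.trans (hfA a ha))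

/-- The Riesz–Markov–Kakutani theorem for normalized positive functionals on a compact space. -/
theorem exists_regular_probabilityMeasure_integral_eq {K : Type*} [TopologicalSpace K]
    [CompactSpace K] [T2Space K] [MeasurableSpace K] [BorelSpace K] (l : C(K, ℝ) →ₗ[ℝ] ℝ)
    (hl : ∀ g, 0 ≤ g → 0 ≤ l g) (hl1 : l 1 = 1) :
    ∃ μ : Measure K, IsProbabilityMeasure μ ∧ μ.Regular ∧ ∀ g : C(K, ℝ), ∫ x, g x ∂μ = l g := by
  let e : CompactlySupportedContinuousMap K ℝ →ₗ[ℝ] C(K, ℝ) :=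
    { toFun := fun g => g.toContinuousMap
      map_add' := fun _ _ => rfl
      map_smul' := fun _ _ => rfl }
  let L : CompactlySupportedContinuousMap K ℝ →ₚ[ℝ] ℝ :=
    PositiveLinearMap.mk₀ (l ∘ₗ e) fun g hg => hl _ hg
  have hint : ∀ g : C(K, ℝ), ∫ x, g x ∂(RealRMK.rieszMeasure L) = l g := fun g =>
    RealRMK.integral_rieszMeasure L (CompactlySupportedContinuousMap.continuousMapEquiv g)
  refine ⟨RealRMK.rieszMeasure L, ?_, inferInstance, hint⟩
  have h1 := hint 1
  simp only [ContinuousMap.one_apply, integral_const, smul_eq_mul, mul_one, hl1] at h1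
  constructor
  rw [measureReal_def] at h1
  exact (ENNReal.toReal_eq_one_iff _).1 h1

/-- A positively homogeneous family of inequalities whose finite sums hold at some point of `K × L`
holds on integrating against suitable regular probability measures on `K` and `L`. -/
theorem exists_regular_probabilityMeasures_le_integral_add_integral
    {ι K L : Type*} [Nonempty ι]
    [TopologicalSpace K] [CompactSpace K] [T2Space K] [MeasurableSpace K] [BorelSpace K]
    [TopologicalSpace L] [CompactSpace L] [T2Space L] [MeasurableSpace L] [BorelSpace L]
    (a : ι → ℝ) (g : ι → C(K, ℝ)) (h : ι → C(L, ℝ))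
    (hscale : ∀ c : ℝ, 0 ≤ c → ∀ i, ∃ j, a j = c * a i ∧ g j = c • g i ∧ h j = c • h i)
    (hsum : ∀ (m : ℕ) (i : Fin m → ι), ∃ x y, ∑ k, a (i k) ≤ ∑ k, g (i k) x + ∑ k, h (i k) y) :
    ∃ (μ : Measure K) (τ : Measure L), IsProbabilityMeasure μ ∧ μ.Regular ∧
      IsProbabilityMeasure τ ∧ τ.Regular ∧ ∀ i, a i ≤ ∫ x, g i x ∂μ + ∫ y, h i y ∂τ := by
  let fstMap : C(K × L, K) := ⟨Prod.fst, continuous_fst⟩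
  let sndMap : C(K × L, L) := ⟨Prod.snd, continuous_snd⟩
  let Φ : ι → C(K × L, ℝ) := fun i =>
    a i • (1 : C(K × L, ℝ)) - ((g i).comp fstMap + (h i).comp sndMap)
  have hΦ : ∀ z ∈ convexHull ℝ (Set.range Φ), ∃ x, z x ≤ 0 := by
    intro z hz
    rw [convexHull_eq] at hz
    obtain ⟨κ, t, w, y, hw, hw1, hy, rfl⟩ := hz
    choose! i hi using hy
    -- Homogeneity absorbs the convex weights into the indices, so unweighted finite sums suffice.
    have hsc : ∀ k ∈ t, ∃ j, Φ j = w k • y k := by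
      intro k hk
      obtain ⟨j, h1, h2, h3⟩ := hscale (w k) (hw k hk) (i k)
      refine ⟨j, ?_⟩
      rw [← hi k hk]
      ext x
      simp [Φ, h1, h2, h3]
      ring
    choose! j hj using hsc
    rw [Finset.centerMass_eq_of_sum_1 _ _ hw1]
    obtain ⟨x₁, x₂, hx⟩ := hsum t.card fun k => j (t.equivFin.symm k)
    refine ⟨(x₁, x₂), ?_⟩
    rw [← Finset.sum_congr rfl hj, ← Finset.sum_coe_sort, ← t.equivFin.symm.sum_comp]
    simp only [ContinuousMap.sum_apply]
    rw [← Finset.sum_add_distrib, ← sub_nonpos, ← Finset.sum_sub_distrib] at hx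
    simpa [Φ, fstMap, sndMap] using hx
  obtain ⟨l, hl, hl1, hlA⟩ := exists_positive_functional_nonpos (convex_convexHull ℝ (Set.range Φ))
    (convexHull_nonempty_iff.2 (Set.range_nonempty Φ)) hΦ
  -- Each `Φ i` splits into functions of one variable, so only the two marginals of l matter and no
  -- measure on K × L is needed.
  let eK : C(K, ℝ) →ₗ[ℝ] C(K × L, ℝ) :=
    { toFun := fun g => g.comp fstMap
      map_add' := fun _ _ => rfl
      map_smul' := fun _ _ => rfl }
  let eL : C(L, ℝ) →ₗ[ℝ] C(K × L, ℝ) :=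
    { toFun := fun g => g.comp sndMap
      map_add' := fun _ _ => rfl
      map_smul' := fun _ _ => rfl }
  obtain ⟨μ, hμ, hμr, hμi⟩ := exists_regular_probabilityMeasure_integral_eq (l ∘ₗ eK)
    (fun g hg => hl _ fun x => hg x.1) hl1
  obtain ⟨τ, hτ, hτr, hτi⟩ := exists_regular_probabilityMeasure_integral_eq (l ∘ₗ eL)
    (fun g hg => hl _ fun x => hg x.2) hl1
  refine ⟨μ, τ, hμ, hμr, hτ, hτr, fun i => ?_⟩
  rw [hμi, hτi]
  have := hlA (Φ i) (subset_convexHull ℝ _ ⟨i, rfl⟩)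
  simp only [Φ, map_sub, map_add, map_smul, hl1, smul_eq_mul, mul_one] at this
  simpa [eK, eL] using this

/-- The norm of a continuous function in `L^p` of a finite measure on a compact space. -/
theorem norm_toLp_eq_integral {𝕜 : Type*} [RCLike 𝕜] {K : Type*} [TopologicalSpace K]
    [CompactSpace K] [MeasurableSpace K] [BorelSpace K] (μ : Measure K) [IsFiniteMeasure μ]
    {p : ℝ} (hp : 1 ≤ p) [Fact (1 ≤ ENNReal.ofReal p)] (g : C(K, 𝕜)) :
    ‖ContinuousMap.toLp (E := 𝕜) (ENNReal.ofReal p) μ 𝕜 g‖ = (∫ x, ‖g x‖ ^ p ∂μ) ^ (1 / p) := by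
  have hp0 : 0 < p := by linarith
  have hmem : MemLp g (ENNReal.ofReal p) μ := ContinuousMap.memLp μ 𝕜 g
  rw [Lp.norm_def, eLpNorm_congr_ae (ContinuousMap.coeFn_toLp (𝕜 := 𝕜) μ g),
    hmem.eLpNorm_eq_integral_rpow_norm (by simpa using hp0) ENNReal.ofReal_ne_top,
    ENNReal.toReal_ofReal (by positivity), ENNReal.toReal_ofReal hp0.le, one_div]

/-! ### The compact balls -/

namespace LipUnitBall

variable {X : Type u} [MetricSpace X] {x₀ : X}

theorem continuous_eval (x : X) : Continuous fun f : LipUnitBall x₀ => f x :=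
  (continuous_apply x).comp continuous_induced_dom

theorem abs_sub_le_dist (f : LipUnitBall x₀) (x y : X) : |f x - f y| ≤ dist x y := by
  simpa [Real.dist_eq] using f.2.1.dist_le_mul x y

instance : Nonempty (LipUnitBall x₀) :=
  ⟨⟨fun _ => 0, LipschitzWith.const' 0, rfl⟩⟩

instance : T2Space (LipUnitBall x₀) :=
  T2Space.of_injective_continuous (f := fun f : LipUnitBall x₀ => (f : X → ℝ))
    Subtype.val_injective continuous_induced_dom

/-- Tychonoff: vanishing at x₀ confines f x to the interval of radius d(x, x₀), and the defining
conditions are pointwise closed. -/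
instance : CompactSpace (LipUnitBall x₀) := by
  have hind : Topology.IsInducing fun f : LipUnitBall x₀ => (f : X → ℝ) := ⟨rfl⟩
  refine ⟨hind.isCompact_iff.2 ?_⟩
  have hsub : (fun f : LipUnitBall x₀ => (f : X → ℝ)) '' Set.univ
      ⊆ Set.pi Set.univ fun x => Metric.closedBall 0 (dist x x₀) := by
    rintro _ ⟨f, -, rfl⟩ x -
    have := abs_sub_le_dist f x x₀
    rw [f.2.2, sub_zero] at this
    simpa [Real.dist_eq] using this
  refine (isCompact_univ_pi fun x => isCompact_closedBall _ _).of_isClosed_subset ?_ hsub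
  have heq : (fun f : LipUnitBall x₀ => (f : X → ℝ)) '' Set.univ
      = {f : X → ℝ | ∀ x y, dist (f x) (f y) ≤ dist x y} ∩ {f | f x₀ = 0} := by
    ext f
    constructor
    · rintro ⟨g, -, rfl⟩
      exact ⟨fun x y => by simpa using g.2.1.dist_le_mul x y, g.2.2⟩
    · rintro ⟨h1, h2⟩
      exact ⟨⟨f, LipschitzWith.of_dist_le_mul fun x y => by simpa using h1 x y, h2⟩, trivial, rfl⟩
  rw [heq]
  refine IsClosed.inter ?_ (isClosed_eq (continuous_apply x₀) continuous_const)
  have : {f : X → ℝ | ∀ x y, dist (f x) (f y) ≤ dist x y}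
      = ⋂ x, ⋂ y, {f : X → ℝ | dist (f x) (f y) ≤ dist x y} := by
    ext f
    simp
  rw [this]
  exact isClosed_iInter fun x => isClosed_iInter fun y =>
    isClosed_le ((continuous_apply x).dist (continuous_apply y)) continuous_const

end LipUnitBall

namespace DualUnitBall

variable {𝕜 : Type} [RCLike 𝕜] {E : Type v} [NormedAddCommGroup E] [NormedSpace 𝕜 E]

theorem continuous_eval (a : E) : Continuous fun ξ : DualUnitBall 𝕜 E => ξ a :=
  (WeakDual.eval_continuous a).comp continuous_induced_dom

theorem norm_apply_le (ξ : DualUnitBall 𝕜 E) (a : E) : ‖ξ a‖ ≤ ‖a‖ := by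
  have := (WeakDual.toStrongDual ξ.1).le_of_opNorm_le ξ.2 a
  simpa using this

instance : Nonempty (DualUnitBall 𝕜 E) :=
  ⟨⟨0, by simp⟩⟩

instance : T2Space (DualUnitBall 𝕜 E) :=
  T2Space.of_injective_continuous (f := fun ξ : DualUnitBall 𝕜 E => ξ.1)
    Subtype.val_injective continuous_induced_dom

instance : CompactSpace (DualUnitBall 𝕜 E) := by
  have hind : Topology.IsInducing fun ξ : DualUnitBall 𝕜 E => ξ.1 := ⟨rfl⟩
  refine ⟨hind.isCompact_iff.2 ?_⟩
  have h := WeakDual.isCompact_closedBall (𝕜 := 𝕜) (0 : StrongDual 𝕜 E) 1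
  convert h using 1
  ext ξ
  constructor
  · rintro ⟨η, -, rfl⟩
    simpa using η.2
  · intro hξ
    exact ⟨⟨ξ, by simpa using hξ⟩, trivial, rfl⟩

end DualUnitBall

/-! ### Powers and suprema -/

/-- Identifies the weight a^{1/(1-θ)} d^{θ/(1-θ)} that turns an interpolated term into a term of an
ordinary weighted ℓ_p sum. -/
theorem mul_rpow_mul_rpow_rpow {a y d p θ : ℝ} (ha : 0 ≤ a) (hy : 0 ≤ y) (hd : 0 ≤ d)
    (hθ : θ < 1) :
    (a * y ^ (1 - θ) * d ^ θ) ^ (p / (1 - θ))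
      = (a ^ (1 / (1 - θ)) * d ^ (θ / (1 - θ))) ^ p * y ^ p := by
  have h : 1 - θ ≠ 0 := by linarith
  rw [Real.mul_rpow (by positivity) (by positivity), Real.mul_rpow ha (by positivity),
    Real.mul_rpow (by positivity) (by positivity), ← Real.rpow_mul hy, ← Real.rpow_mul hd,
    ← Real.rpow_mul ha, ← Real.rpow_mul hd]
  rw [show (1 - θ) * (p / (1 - θ)) = p by field_simp,
    show θ * (p / (1 - θ)) = θ / (1 - θ) * p by ring,
    show 1 / (1 - θ) * p = p / (1 - θ) by ring]
  ring

/-- The hypothesis is raised to the power 1-θ, which is monotone and passes through the supremum.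
Boundedness is needed because a real supremum of an unbounded family defaults to 0. -/
theorem rpow_le_mul_iSup_rpow {K : Type*} [Nonempty K] {A C p θ : ℝ} {B : K → ℝ} (hp : 0 < p)
    (hθ : θ < 1) (hA : 0 ≤ A) (hC : 0 ≤ C) (hB : ∀ k, 0 ≤ B k)
    (hbdd : BddAbove (Set.range fun k => B k ^ ((1 - θ) / p)))
    (h : A ^ (1 / p) ≤ C * ⨆ k, B k ^ (1 / p)) :
    A ^ ((1 - θ) / p) ≤ C ^ (1 - θ) * ⨆ k, B k ^ ((1 - θ) / p) := by
  have hθ' : 0 < 1 - θ := by linarith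
  set D := ⨆ k, B k ^ ((1 - θ) / p) with hD
  have hD0 : 0 ≤ D := Real.iSup_nonneg fun k => Real.rpow_nonneg (hB k) _
  have hW : ⨆ k, B k ^ (1 / p) ≤ D ^ (1 / (1 - θ)) := by
    refine ciSup_le fun k => ?_
    rw [show 1 / p = (1 - θ) / p * (1 / (1 - θ)) by field_simp, Real.rpow_mul (hB k)]
    exact Real.rpow_le_rpow (Real.rpow_nonneg (hB k) _) (le_ciSup hbdd k) (by positivity)
  calc A ^ ((1 - θ) / p) = (A ^ (1 / p)) ^ (1 - θ) := by
        rw [← Real.rpow_mul hA]; congr 1; ring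
    _ ≤ (C * D ^ (1 / (1 - θ))) ^ (1 - θ) := by
        refine Real.rpow_le_rpow (by positivity) (h.trans ?_) hθ'.le
        exact mul_le_mul_of_nonneg_left hW hC
    _ = C ^ (1 - θ) * D := by
        rw [Real.mul_rpow hC (by positivity), ← Real.rpow_mul hD0, one_div,
          inv_mul_cancel₀ hθ'.ne', Real.rpow_one]

/-- The admissible constants form a closed set bounded below, so their infimum is attained; hence
π_q(R) and π_p^L(S) are themselves admissible. -/
theorem sInf_mem_setOf_forall_le_mul {ι : Type*} {A B : ι → ℝ}
    (h : ∃ C, 0 ≤ C ∧ ∀ i, A i ≤ C * B i) :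
    0 ≤ sInf {C | 0 ≤ C ∧ ∀ i, A i ≤ C * B i} ∧
      ∀ i, A i ≤ sInf {C | 0 ≤ C ∧ ∀ i, A i ≤ C * B i} * B i := by
  have hcl : IsClosed {C : ℝ | 0 ≤ C ∧ ∀ i, A i ≤ C * B i} := by
    have : {C : ℝ | 0 ≤ C ∧ ∀ i, A i ≤ C * B i} = Set.Ici 0 ∩ ⋂ i, {C | A i ≤ C * B i} := by
      ext C
      simp
    rw [this]
    exact isClosed_Ici.inter (isClosed_iInter fun i =>
      isClosed_le continuous_const (continuous_id.mul continuous_const))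
  exact hcl.csInf_mem h ⟨0, fun C hC => hC.1⟩

theorem sum_integral_le_of_forall_sum_le {K : Type*} [TopologicalSpace K] [CompactSpace K]
    [MeasurableSpace K] [BorelSpace K] (μ : Measure K) [IsProbabilityMeasure μ] {m : ℕ}
    {g : Fin m → K → ℝ} (hg : ∀ j, Continuous (g j)) {M : ℝ} (h : ∀ x, ∑ j, g j x ≤ M) :
    ∑ j, ∫ x, g j x ∂μ ≤ M := by
  have hi : ∀ {k : K → ℝ}, Continuous k → Integrable k μ := fun hk =>
    hk.integrable_of_hasCompactSupport (HasCompactSupport.of_compactSpace _)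
  rw [← integral_finsetSum _ fun j _ => hi (hg j)]
  calc ∫ x, ∑ j, g j x ∂μ ≤ ∫ _, M ∂μ :=
        integral_mono (hi (continuous_finsetSum _ fun j _ => hg j)) (integrable_const M) h
    _ = M := by simp

/-! ### Interpolated forms of the summing inequalities; attainment of the summing norms -/

section Norms

variable {𝕜 : Type} [RCLike 𝕜] {E : Type v} [NormedAddCommGroup E] [NormedSpace 𝕜 E]
  {X : Type u} [MetricSpace X] {x₀ : X}

theorem LipUnitBall.continuous_delta {p θ : ℝ} (hp : 1 ≤ p) (hθ' : θ < 1)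
    (σ : ℝ) (x' x'' : X) : Continuous fun f : LipUnitBall x₀ =>
      (|σ| * |f x' - f x''| ^ (1 - θ) * dist x' x'' ^ θ) ^ (p / (1 - θ)) := by
  have h : 0 < 1 - θ := by linarith
  have h1 := continuous_eval (x₀ := x₀) x'
  have h2 := continuous_eval (x₀ := x₀) x''
  have h3 : Continuous fun f : LipUnitBall x₀ => |f x' - f x''| ^ (1 - θ) :=
    (h1.sub h2).abs.rpow_const fun _ => Or.inr h.le
  exact ((continuous_const.mul h3).mul continuous_const).rpow_const fun _ => Or.inr (by positivity)

theorem DualUnitBall.continuous_delta {p θ : ℝ} (hp : 1 ≤ p) (hθ' : θ < 1)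
    (a : E) : Continuous fun ξ : DualUnitBall 𝕜 E =>
      (‖ξ a‖ ^ (1 - θ) * ‖a‖ ^ θ) ^ (p / (1 - θ)) := by
  have h : 0 < 1 - θ := by linarith
  have h1 := continuous_eval (𝕜 := 𝕜) a
  have h3 : Continuous fun ξ : DualUnitBall 𝕜 E => ‖ξ a‖ ^ (1 - θ) :=
    h1.norm.rpow_const fun _ => Or.inr h.le
  exact (h3.mul continuous_const).rpow_const fun _ => Or.inr (by positivity)

theorem bddAbove_range_sum_rpow {K : Type*} [TopologicalSpace K] [CompactSpace K] {m : ℕ}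
    {g : Fin m → K → ℝ} (hg : ∀ j, Continuous (g j)) {s : ℝ} (hs : 0 ≤ s) :
    BddAbove (Set.range fun x => (∑ j, g j x) ^ s) :=
  (isCompact_range ((continuous_finsetSum _ fun j _ => hg j).rpow_const
    fun _ => Or.inr hs)).bddAbove

theorem IsLipSummingConst.sum_rpow_le_lipDeltaNorm {G : Type*} [NormedAddCommGroup G]
    {p θ K : ℝ} {S : X → G} (hS : IsLipSummingConst x₀ p S K) (hp : 1 ≤ p) (hθ' : θ < 1)
    {m : ℕ} (σ : Fin m → ℝ) (x' x'' : Fin m → X) :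
    (∑ j, (|σ j| * ‖S (x' j) - S (x'' j)‖ ^ (1 - θ) * dist (x' j) (x'' j) ^ θ) ^ (p / (1 - θ)))
      ^ ((1 - θ) / p) ≤ K ^ (1 - θ) * lipDeltaNorm x₀ p θ σ x' x'' := by
  have h : 0 < 1 - θ := by linarith
  refine rpow_le_mul_iSup_rpow (by linarith) hθ' (by positivity) hS.1
    (fun f => by positivity)
    (bddAbove_range_sum_rpow (fun j => LipUnitBall.continuous_delta hp hθ' _ _ _)
      (by positivity)) ?_
  have key := hS.2 m
    (fun j => |σ j| ^ (1 / (1 - θ)) * dist (x' j) (x'' j) ^ (θ / (1 - θ))) x' x''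
    fun j => by positivity
  have habs : ∀ j, |(|σ j| ^ (1 / (1 - θ)) * dist (x' j) (x'' j) ^ (θ / (1 - θ)))|
      = |σ j| ^ (1 / (1 - θ)) * dist (x' j) (x'' j) ^ (θ / (1 - θ)) := fun j =>
    abs_of_nonneg (by positivity)
  simp only [lipEllNorm, lipWeakEllNorm, dist_eq_norm (S _), habs] at key
  simpa only [mul_rpow_mul_rpow_rpow (abs_nonneg _) (norm_nonneg _) dist_nonneg hθ',
    mul_rpow_mul_rpow_rpow (abs_nonneg _) (abs_nonneg _) dist_nonneg hθ'] using key

theorem IsSummingConst.sum_rpow_le_deltaNorm {H : Type*} [NormedAddCommGroup H] [NormedSpace 𝕜 H]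
    {q ν K : ℝ} {R : E →L[𝕜] H} (hR : IsSummingConst 𝕜 q R K) (hq : 1 ≤ q) (hν' : ν < 1)
    {m : ℕ} (b : Fin m → E) :
    (∑ j, (‖R (b j)‖ ^ (1 - ν) * ‖b j‖ ^ ν) ^ (q / (1 - ν))) ^ ((1 - ν) / q)
      ≤ K ^ (1 - ν) * deltaNorm 𝕜 q ν b := by
  have h : 0 < 1 - ν := by linarith
  refine rpow_le_mul_iSup_rpow (by linarith) hν' (by positivity) hR.1
    (fun f => by positivity)
    (bddAbove_range_sum_rpow (fun j => DualUnitBall.continuous_delta hq hν' _)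
      (by positivity)) ?_
  -- The linear definition has no weights; homogeneity of R lets the weight ‖b‖^{ν/(1-ν)} multiply
  -- the vector instead.
  have key := hR.2 m fun j => ((‖b j‖ ^ (ν / (1 - ν)) : ℝ) : 𝕜) • b j
  have hn : ∀ j, ‖((‖b j‖ ^ (ν / (1 - ν)) : ℝ) : 𝕜)‖ = ‖b j‖ ^ (ν / (1 - ν)) := fun j => by
    rw [RCLike.norm_ofReal, abs_of_nonneg (by positivity)]
  have hpow : ∀ (j : Fin m) {y : ℝ}, 0 ≤ y → (y ^ (1 - ν) * ‖b j‖ ^ ν) ^ (q / (1 - ν))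
      = (‖b j‖ ^ (ν / (1 - ν)) * y) ^ q := fun j y hy => by
    have := mul_rpow_mul_rpow_rpow (p := q) zero_le_one hy (norm_nonneg (b j)) hν'
    rw [one_mul, Real.one_rpow, one_mul] at this
    rw [this, Real.mul_rpow (by positivity) hy]
  simp only [ellNorm, weakEllNorm, map_smul, norm_smul, hn]
    at key
  simpa only [hpow _ (norm_nonneg _)] using key

theorem IsSumming.isSummingConst_summingNorm {H : Type*} [NormedAddCommGroup H] [NormedSpace 𝕜 H]
    {q : ℝ} {R : E →L[𝕜] H} (hR : IsSumming 𝕜 q R) :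
    IsSummingConst 𝕜 q R (summingNorm 𝕜 q R) := by
  have := sInf_mem_setOf_forall_le_mul (ι := Σ m : ℕ, Fin m → E)
    (A := fun a => ellNorm q fun j => R (a.2 j)) (B := fun a => weakEllNorm 𝕜 q a.2)
    (by simpa [IsSumming, IsSummingConst, Sigma.forall] using hR)
  simpa [summingNorm, IsSummingConst, Sigma.forall] using this

theorem IsLipSumming.isLipSummingConst_lipSummingNorm {Y : Type*} [MetricSpace Y]
    {p : ℝ} {S : X → Y} (hS : IsLipSumming x₀ p S) :
    IsLipSummingConst x₀ p S (lipSummingNorm x₀ p S) := by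
  -- The sign condition on the weights is packed into the index type.
  have := sInf_mem_setOf_forall_le_mul
    (ι := Σ m : ℕ, {a : (Fin m → ℝ) × (Fin m → X) × (Fin m → X) // ∀ j, 0 ≤ a.1 j})
    (A := fun a => lipEllNorm p a.2.1.1 (fun j => S (a.2.1.2.1 j)) fun j => S (a.2.1.2.2 j))
    (B := fun a => lipWeakEllNorm x₀ p a.2.1.1 a.2.1.2.1 a.2.1.2.2)
    (by
      obtain ⟨C, hC, h⟩ := hS.2
      exact ⟨C, hC, fun a => h a.1 _ _ _ a.2.2⟩)
  have hset : {C | IsLipSummingConst x₀ p S C} = {C | 0 ≤ C ∧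
      ∀ a : Σ m : ℕ, {a : (Fin m → ℝ) × (Fin m → X) × (Fin m → X) // ∀ j, 0 ≤ a.1 j},
        lipEllNorm p a.2.1.1 (fun j => S (a.2.1.2.1 j)) (fun j => S (a.2.1.2.2 j))
          ≤ C * lipWeakEllNorm x₀ p a.2.1.1 a.2.1.2.1 a.2.1.2.2} := by
    ext C
    exact ⟨fun h => ⟨h.1, fun a => h.2 a.1 _ _ _ a.2.2⟩,
      fun h => ⟨h.1, fun m lam x' x'' hl => h.2 ⟨m, (lam, x', x''), hl⟩⟩⟩
  rw [← hset] at this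
  exact ⟨this.1, fun m lam x' x'' hl => this.2 ⟨m, (lam, x', x''), hl⟩⟩

end Norms

/-! ### Dominated, integral-dominated and mixed summing maps -/

section Implications

variable {𝕜 : Type} [RCLike 𝕜] {X : Type u} [MetricSpace X] {x₀ : X}
  {F : Type v} [NormedAddCommGroup F] [NormedSpace 𝕜 F] {p θ q ν s C : ℝ} {T : X → F}

theorem holderTriple_conjExponent {r : ℝ} (hp : 1 ≤ p) (hq : 1 ≤ q) (hθ' : θ < 1) (hν' : ν < 1)
    (hr : 1 ≤ r) (hpqr : 1 / r + (1 - θ) / p + (1 - ν) / q = 1) :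
    Real.HolderTriple (p / (1 - θ)) (q / (1 - ν)) (Real.conjExponent r) := by
  have hα : 0 < (1 - θ) / p := div_pos (by linarith) (by linarith)
  have hβ : 0 < (1 - ν) / q := div_pos (by linarith) (by linarith)
  -- The other two fractions are positive, so 1/r < 1.
  have hr1 : 1 < r := by
    refine lt_of_le_of_ne hr fun h => ?_
    rw [← h] at hpqr
    linarith
  have hc := (Real.HolderConjugate.conjExponent hr1).inv_add_inv_eq_one
  refine ⟨?_, div_pos (by linarith) (by linarith), div_pos (by linarith) (by linarith)⟩
  rw [inv_div, inv_div]
  rw [one_div] at hpqr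
  linarith

/-- Each term is at most C U_j V_j, where U_j involves only S and V_j only R. Hölder separates the
two sequences, and each factor is bounded by its summing inequality. -/
theorem IsAdmissible.isMixedSummingConst {G H : Type*} [NormedAddCommGroup G]
    [NormedAddCommGroup H] [NormedSpace 𝕜 H] {S : X → G} {R : StrongDual 𝕜 F →L[𝕜] H}
    (h : IsAdmissible 𝕜 x₀ p θ q ν T S R C) (hp : 1 ≤ p) (hq : 1 ≤ q) (hθ' : θ < 1) (hν' : ν < 1)
    (hs : Real.HolderTriple (p / (1 - θ)) (q / (1 - ν)) s) :
    IsMixedSummingConst 𝕜 x₀ p θ q ν s T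
      (C * lipSummingNorm x₀ p S ^ (1 - θ) * summingNorm 𝕜 q R ^ (1 - ν)) := by
  obtain ⟨hS, hR, hC, hdom⟩ := h
  have hS' := hS.isLipSummingConst_lipSummingNorm
  have hR' := hR.isSummingConst_summingNorm
  have hπS := hS'.1
  have hπR := hR'.1
  have hs0 : 0 < s := hs.pos'
  refine ⟨by positivity, fun m σ x' x'' b => ?_⟩
  have h1 := hS'.sum_rpow_le_lipDeltaNorm hp hθ' σ x' x''
  have h2 := hR'.sum_rpow_le_deltaNorm hq hν' b
  set U : Fin m → ℝ := fun j =>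
    |σ j| * ‖S (x' j) - S (x'' j)‖ ^ (1 - θ) * dist (x' j) (x'' j) ^ θ with hU
  set V : Fin m → ℝ := fun j => ‖R (b j)‖ ^ (1 - ν) * ‖b j‖ ^ ν with hV
  have hU0 : ∀ j, 0 ≤ U j := fun j => by positivity
  have hV0 : ∀ j, 0 ≤ V j := fun j => by positivity
  have hterm : ∀ j, ‖(σ j : 𝕜) * b j (T (x' j) - T (x'' j))‖ ≤ C * (U j * V j) := by
    intro j
    rw [norm_mul, RCLike.norm_ofReal]
    refine (mul_le_mul_of_nonneg_left (hdom (x' j) (x'' j) (b j)) (abs_nonneg _)).trans_eq ?_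
    simp only [hU, hV]
    ring
  have hsum : ∑ j, ‖(σ j : 𝕜) * b j (T (x' j) - T (x'' j))‖ ^ s
      ≤ C ^ s * ((∑ j, U j ^ (p / (1 - θ))) ^ (s / (p / (1 - θ))) *
        (∑ j, V j ^ (q / (1 - ν))) ^ (s / (q / (1 - ν)))) := by
    calc ∑ j, ‖(σ j : 𝕜) * b j (T (x' j) - T (x'' j))‖ ^ s
        ≤ ∑ j, C ^ s * (U j * V j) ^ s := by
          refine Finset.sum_le_sum fun j _ => ?_
          rw [← Real.mul_rpow hC.le (mul_nonneg (hU0 j) (hV0 j))]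
          exact Real.rpow_le_rpow (norm_nonneg _) (hterm j) hs0.le
      _ = C ^ s * ∑ j, (U j * V j) ^ s := by rw [Finset.mul_sum]
      _ ≤ _ := by
          refine mul_le_mul_of_nonneg_left ?_ (by positivity)
          exact Real.Lr_rpow_le_Lp_mul_Lq_of_nonneg _ hs (fun j _ => hU0 j) fun j _ => hV0 j
  have hA : 0 ≤ ∑ j, U j ^ (p / (1 - θ)) := Finset.sum_nonneg fun j _ => Real.rpow_nonneg (hU0 j) _
  have hB : 0 ≤ ∑ j, V j ^ (q / (1 - ν)) := Finset.sum_nonneg fun j _ => Real.rpow_nonneg (hV0 j) _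
  calc ellNorm s (fun j => (σ j : 𝕜) * b j (T (x' j) - T (x'' j)))
      ≤ (C ^ s * ((∑ j, U j ^ (p / (1 - θ))) ^ (s / (p / (1 - θ))) *
        (∑ j, V j ^ (q / (1 - ν))) ^ (s / (q / (1 - ν))))) ^ (1 / s) :=
        Real.rpow_le_rpow (Finset.sum_nonneg fun j _ => by positivity) hsum (by positivity)
    _ = C * ((∑ j, U j ^ (p / (1 - θ))) ^ ((1 - θ) / p) *
        (∑ j, V j ^ (q / (1 - ν))) ^ ((1 - ν) / q)) := by
        rw [Real.mul_rpow (by positivity) (by positivity),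
          Real.mul_rpow (by positivity) (by positivity), ← Real.rpow_mul hC.le,
          ← Real.rpow_mul hA, ← Real.rpow_mul hB, mul_one_div_cancel hs0.ne', Real.rpow_one,
          show s / (p / (1 - θ)) * (1 / s) = (1 - θ) / p by field_simp,
          show s / (q / (1 - ν)) * (1 / s) = (1 - ν) / q by field_simp]
    _ ≤ C * ((lipSummingNorm x₀ p S ^ (1 - θ) * lipDeltaNorm x₀ p θ σ x' x'') *
        (summingNorm 𝕜 q R ^ (1 - ν) * deltaNorm 𝕜 q ν b)) :=
        mul_le_mul_of_nonneg_left (mul_le_mul h1 h2 (by positivity)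
          ((Real.rpow_nonneg hA _).trans h1)) hC.le
    _ = _ := by ring

/-- Scaling acts on the Lipschitz factor through σ alone and on the linear factor through b alone
(`delta_smul`), so the two can be scaled independently. -/
theorem lipDelta_mul {c σ y d : ℝ} (P θ : ℝ) (hc : 0 ≤ c) (hy : 0 ≤ y) (hd : 0 ≤ d) :
    (|c * σ| * y ^ (1 - θ) * d ^ θ) ^ P = c ^ P * (|σ| * y ^ (1 - θ) * d ^ θ) ^ P := by
  rw [abs_mul, abs_of_nonneg hc, ← Real.mul_rpow hc (by positivity)]
  congr 1
  ring

theorem delta_smul {E : Type*} [NormedAddCommGroup E] [NormedSpace 𝕜 E] {c : ℝ} (Q : ℝ)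
    (hν : 0 ≤ ν) (hν' : ν < 1) (hc : 0 ≤ c) (ξ : DualUnitBall 𝕜 E) (b : E) :
    (‖ξ ((c : 𝕜) • b)‖ ^ (1 - ν) * ‖(c : 𝕜) • b‖ ^ ν) ^ Q
      = c ^ Q * (‖ξ b‖ ^ (1 - ν) * ‖b‖ ^ ν) ^ Q := by
  rw [map_smul, norm_smul, norm_smul, RCLike.norm_ofReal, abs_of_nonneg hc,
    Real.mul_rpow hc (norm_nonneg (ξ b)), Real.mul_rpow hc (norm_nonneg b),
    ← Real.mul_rpow (z := Q) hc (by positivity)]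
  congr 1
  -- Also valid at c = 0, since both exponents are nonnegative.
  have : c ^ (1 - ν) * c ^ ν = c := by
    rw [← Real.rpow_add_of_nonneg hc (by linarith) hν, sub_add_cancel, Real.rpow_one]
  linear_combination (‖ξ b‖ ^ (1 - ν) * ‖b‖ ^ ν) * this

/-- Letting ε → 0 by continuity spares the optimization below the degenerate cases I = 0 and J = 0.
-/
theorem le_of_forall_pos_add_rpow {N C I J α β : ℝ} (hα : 0 ≤ α) (hβ : 0 ≤ β)
    (h : ∀ ε > 0, N ≤ C * (I + ε) ^ α * (J + ε) ^ β) : N ≤ C * I ^ α * J ^ β := by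
  have hcont : Continuous fun ε : ℝ => C * (I + ε) ^ α * (J + ε) ^ β :=
    (continuous_const.mul ((continuous_const.add continuous_id).rpow_const fun _ => Or.inr hα)).mul
      ((continuous_const.add continuous_id).rpow_const fun _ => Or.inr hβ)
  have hlim := (hcont.tendsto 0).mono_left (nhdsWithin_le_nhds (s := Set.Ioi 0))
  simp only [add_zero] at hlim
  exact ge_of_tendsto hlim (Filter.eventually_of_mem self_mem_nhdsWithin fun ε hε => h ε hε)

/-- Optimization of a two-parameter family of Young inequalities gives the product inequality. -/
theorem le_mul_rpow_of_forall_scaled_le {N C I J P Q s : ℝ} (hs : Real.HolderTriple P Q s)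
    (hN : 0 ≤ N) (hC : 0 ≤ C) (hI : 0 ≤ I) (hJ : 0 ≤ J)
    (h : ∀ c e : ℝ, 0 < c → 0 < e →
      (c * e * N) ^ s ≤ C ^ s * (s / P) * (c ^ P * I) + C ^ s * (s / Q) * (e ^ Q * J)) :
    N ≤ C * I ^ P⁻¹ * J ^ Q⁻¹ := by
  have hP : 0 < P := hs.left_pos
  have hQ : 0 < Q := hs.right_pos
  have hs0 : 0 < s := hs.pos'
  refine le_of_forall_pos_add_rpow (by positivity) (by positivity) fun ε hε => ?_
  have hIε : 0 < I + ε := by linarith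
  have hJε : 0 < J + ε := by linarith
  -- These scalings normalize both integrals to at most 1; the Young weights s/P and s/Q then add up
  -- to 1.
  have key := h ((I + ε) ^ P⁻¹)⁻¹ ((J + ε) ^ Q⁻¹)⁻¹ (by positivity) (by positivity)
  rw [Real.inv_rpow (by positivity), Real.rpow_inv_rpow hIε.le hP.ne',
    Real.inv_rpow (by positivity), Real.rpow_inv_rpow hJε.le hQ.ne'] at key
  have h1 : (I + ε)⁻¹ * I ≤ 1 := by
    rw [inv_mul_le_iff₀ hIε]
    linarith
  have h2 : (J + ε)⁻¹ * J ≤ 1 := by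
    rw [inv_mul_le_iff₀ hJε]
    linarith
  have hAB : C ^ s * (s / P) * 1 + C ^ s * (s / Q) * 1 = C ^ s := by
    rw [mul_one, mul_one, ← mul_add, div_eq_mul_inv s, div_eq_mul_inv s, ← mul_add,
      hs.inv_add_inv_eq_inv, mul_inv_cancel₀ hs0.ne', mul_one]
  have h3 := key.trans ((add_le_add (mul_le_mul_of_nonneg_left h1 (by positivity))
    (mul_le_mul_of_nonneg_left h2 (by positivity))).trans_eq hAB)
  have h4 := (Real.rpow_le_rpow_iff (by positivity) hC hs0).1 h3
  rw [← mul_inv, inv_mul_le_iff₀ (by positivity)] at h4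
  linarith

/-- By compactness the suprema in (3) are attained, which supplies the points required by the
separation argument. -/
theorem exists_iSup_sum_rpow_le {K : Type*} [TopologicalSpace K] [CompactSpace K] [Nonempty K]
    {m : ℕ} {g : Fin m → K → ℝ} (hg : ∀ j, Continuous (g j)) {s : ℝ} (hs : 0 ≤ s) :
    ∃ x, ⨆ y, (∑ j, g j y) ^ s ≤ (∑ j, g j x) ^ s := by
  have hcont : Continuous fun y => (∑ j, g j y) ^ s :=
    (continuous_finsetSum _ fun j _ => hg j).rpow_const fun _ => Or.inr hs
  obtain ⟨x, -, hx⟩ := isCompact_univ.exists_isMaxOn Set.univ_nonempty hcont.continuousOn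
  exact ⟨x, ciSup_le fun y => hx (Set.mem_univ y)⟩

theorem IsMixedSummingConst.isIntegralConst (h : IsMixedSummingConst 𝕜 x₀ p θ q ν s T C)
    (hp : 1 ≤ p) (hq : 1 ≤ q) (hθ' : θ < 1) (hν : 0 ≤ ν) (hν' : ν < 1)
    (hs : Real.HolderTriple (p / (1 - θ)) (q / (1 - ν)) s) :
    IsIntegralConst 𝕜 x₀ p θ q ν T C := by
  obtain ⟨hC, h⟩ := h
  have hP : 0 < p / (1 - θ) := hs.left_pos
  have hQ : 0 < q / (1 - ν) := hs.right_pos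
  have hs0 : 0 < s := hs.pos'
  have hsum1 : s / (p / (1 - θ)) + s / (q / (1 - ν)) = 1 := by
    have := hs.inv_add_inv_eq_inv
    rw [div_eq_mul_inv s, div_eq_mul_inv s, ← mul_add, this, mul_inv_cancel₀ hs0.ne']
  have hα : (1 - θ) / p = (p / (1 - θ))⁻¹ := (inv_div _ _).symm
  have hβ : (1 - ν) / q = (q / (1 - ν))⁻¹ := (inv_div _ _).symm
  -- A and B carry the weights of Young's inequality (C U^{1/P} V^{1/Q})^s ≤ A U + B V.
  let A : ℝ := C ^ s * (s / (p / (1 - θ)))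
  let B : ℝ := C ^ s * (s / (q / (1 - ν)))
  let a : ℝ × X × X × StrongDual 𝕜 F → ℝ := fun i =>
    ‖(i.1 : 𝕜) * i.2.2.2 (T i.2.1 - T i.2.2.1)‖ ^ s
  let g : ℝ × X × X × StrongDual 𝕜 F → C(LipUnitBall x₀, ℝ) := fun i =>
    A • ⟨_, LipUnitBall.continuous_delta hp hθ' i.1 i.2.1 i.2.2.1⟩
  let k : ℝ × X × X × StrongDual 𝕜 F → C(DualUnitBall 𝕜 (StrongDual 𝕜 F), ℝ) := fun i =>
    B • ⟨_, DualUnitBall.continuous_delta hq hν' i.2.2.2⟩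
  have : Nonempty (ℝ × X × X × StrongDual 𝕜 F) := ⟨(0, x₀, x₀, 0)⟩
  have ha : ∀ (c e σ : ℝ) (x' x'' : X) (b : StrongDual 𝕜 F), 0 ≤ c → 0 ≤ e →
      a (c * σ, x', x'', (e : 𝕜) • b) = (c * e) ^ s * a (σ, x', x'', b) := by
    intro c e σ x' x'' b hc he
    simp only [a]
    rw [← Real.mul_rpow (by positivity) (norm_nonneg _)]
    congr 1
    simp only [smul_apply, smul_eq_mul, norm_mul, RCLike.norm_ofReal, abs_mul,
      abs_of_nonneg hc, abs_of_nonneg he]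
    ring
  have hg : ∀ (c σ : ℝ) (x' x'' : X) (b b' : StrongDual 𝕜 F), 0 ≤ c →
      g (c * σ, x', x'', b) = c ^ (p / (1 - θ)) • g (σ, x', x'', b') := by
    intro c σ x' x'' b b' hc
    ext f
    simp only [g, ContinuousMap.smul_apply, ContinuousMap.coe_mk, smul_eq_mul]
    rw [lipDelta_mul _ _ hc (abs_nonneg _) dist_nonneg]
    ring
  have hk : ∀ (e σ σ' : ℝ) (x' x'' : X) (b : StrongDual 𝕜 F), 0 ≤ e →
      k (σ, x', x'', (e : 𝕜) • b) = e ^ (q / (1 - ν)) • k (σ', x', x'', b) := by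
    intro e σ σ' x' x'' b he
    ext ξ
    simp only [k, ContinuousMap.smul_apply, ContinuousMap.coe_mk, smul_eq_mul]
    rw [delta_smul _ hν hν' he]
    ring
  have hscale : ∀ c : ℝ, 0 ≤ c → ∀ i, ∃ j, a j = c * a i ∧ g j = c • g i ∧ k j = c • k i := by
    rintro c hc ⟨σ, x', x'', b⟩
    -- Scaling σ by c^{1/P} and b by c^{1/Q} multiplies both right-hand functions by c, and the left
    -- side by (c^{1/P + 1/Q})^s = c.
    refine ⟨(c ^ (p / (1 - θ))⁻¹ * σ, x', x'', ((c ^ (q / (1 - ν))⁻¹ : ℝ) : 𝕜) • b), ?_, ?_, ?_⟩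
    · rw [ha _ _ _ _ _ _ (by positivity) (by positivity),
        ← Real.rpow_add_of_nonneg hc (by positivity) (by positivity), hs.inv_add_inv_eq_inv,
        Real.rpow_inv_rpow hc hs0.ne']
    · rw [hg _ _ _ _ _ b (by positivity), Real.rpow_inv_rpow hc hP.ne']
    · rw [hk _ _ σ _ _ _ (by positivity), Real.rpow_inv_rpow hc hQ.ne']
  have hsum : ∀ (m : ℕ) (i : Fin m → ℝ × X × X × StrongDual 𝕜 F),
      ∃ f ξ, ∑ j, a (i j) ≤ ∑ j, g (i j) f + ∑ j, k (i j) ξ := by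
    intro m i
    obtain ⟨f, hf⟩ := exists_iSup_sum_rpow_le (s := (1 - θ) / p) (fun j : Fin m =>
      LipUnitBall.continuous_delta (x₀ := x₀) hp hθ' (i j).1 (i j).2.1 (i j).2.2.1)
      (by rw [hα]; positivity)
    obtain ⟨ξ, hξ⟩ := exists_iSup_sum_rpow_le (s := (1 - ν) / q) (fun j : Fin m =>
      DualUnitBall.continuous_delta (𝕜 := 𝕜) hq hν' (i j).2.2.2) (by rw [hβ]; positivity)
    refine ⟨f, ξ, ?_⟩
    have hm := h m (fun j => (i j).1) (fun j => (i j).2.1) (fun j => (i j).2.2.1)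
      fun j => (i j).2.2.2
    set U := ∑ j, (|(i j).1| * |f (i j).2.1 - f (i j).2.2.1| ^ (1 - θ) *
      dist (i j).2.1 (i j).2.2.1 ^ θ) ^ (p / (1 - θ)) with hU
    set V := ∑ j, (‖ξ (i j).2.2.2‖ ^ (1 - ν) * ‖(i j).2.2.2‖ ^ ν) ^ (q / (1 - ν)) with hV
    have hU0 : 0 ≤ U := Finset.sum_nonneg fun j _ => by positivity
    have hV0 : 0 ≤ V := Finset.sum_nonneg fun j _ => by positivity
    have hgU : ∑ j, g (i j) f = A * U := by
      simp only [g, ContinuousMap.smul_apply, ContinuousMap.coe_mk, smul_eq_mul, hU,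
        Finset.mul_sum]
    have hkV : ∑ j, k (i j) ξ = B * V := by
      simp only [k, ContinuousMap.smul_apply, ContinuousMap.coe_mk, smul_eq_mul, hV,
        Finset.mul_sum]
    rw [hgU, hkV]
    have hbound : (∑ j, a (i j)) ^ (1 / s) ≤ C * U ^ ((1 - θ) / p) * V ^ ((1 - ν) / q) := by
      refine hm.trans ?_
      have hD : 0 ≤ deltaNorm 𝕜 q ν fun j => (i j).2.2.2 :=
        Real.iSup_nonneg fun ξ => by positivity
      exact mul_le_mul (mul_le_mul_of_nonneg_left hf hC) hξ hD (by positivity)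
    have ha0 : 0 ≤ ∑ j, a (i j) := Finset.sum_nonneg fun j _ => by positivity
    rw [one_div, Real.rpow_inv_le_iff_of_pos ha0 (by positivity) hs0] at hbound
    refine hbound.trans ?_
    rw [Real.mul_rpow (by positivity) (by positivity), Real.mul_rpow hC (by positivity),
      ← Real.rpow_mul hU0, ← Real.rpow_mul hV0, hα, hβ, mul_comm _ s, mul_comm _ s,
      ← div_eq_mul_inv, ← div_eq_mul_inv, mul_assoc]
    have hY := Real.geom_mean_le_arith_mean2_weighted (w₁ := s / (p / (1 - θ)))
      (w₂ := s / (q / (1 - ν))) (by positivity) (by positivity) hU0 hV0 hsum1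
    refine (mul_le_mul_of_nonneg_left hY (by positivity)).trans_eq ?_
    simp only [A, B]
    ring
  obtain ⟨μ, τ, hμ, hμr, hτ, hτr, hdom⟩ :=
    exists_regular_probabilityMeasures_le_integral_add_integral a g k hscale hsum
  refine ⟨hC, μ, τ, hμ, hμr, hτ, hτr, fun x' x'' b => ?_⟩
  set I := ∫ f, (|f x' - f x''| ^ (1 - θ) * dist x' x'' ^ θ) ^ (p / (1 - θ)) ∂μ with hI
  set J := ∫ ξ, (‖ξ b‖ ^ (1 - ν) * ‖b‖ ^ ν) ^ (q / (1 - ν)) ∂τ with hJ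
  have hI0 : 0 ≤ I := integral_nonneg fun f => by positivity
  have hJ0 : 0 ≤ J := integral_nonneg fun ξ => by positivity
  have hgI : ∫ f, g (1, x', x'', b) f ∂μ = A * I := by
    simp only [g, ContinuousMap.smul_apply, ContinuousMap.coe_mk, abs_one, one_mul, smul_eq_mul,
      integral_const_mul, hI]
  have hkJ : ∫ ξ, k (1, x', x'', b) ξ ∂τ = B * J := by
    simp only [k, ContinuousMap.smul_apply, ContinuousMap.coe_mk, smul_eq_mul,
      integral_const_mul, hJ]
  rw [hα, hβ]
  refine le_mul_rpow_of_forall_scaled_le hs (norm_nonneg _) hC hI0 hJ0 fun c e hc he => ?_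
  -- Two independent scales c and e are what allow the sum to be optimized back into a product.
  have key := hdom (c * 1, x', x'', (e : 𝕜) • b)
  rw [ha _ _ _ _ _ _ hc.le he.le, hg _ _ _ _ _ b hc.le, hk _ _ 1 _ _ _ he.le] at key
  simp only [ContinuousMap.smul_apply, smul_eq_mul, integral_const_mul] at key
  rw [hgI, hkJ] at key
  simp only [a, RCLike.ofReal_one, one_mul] at key
  rw [Real.mul_rpow (by positivity) (norm_nonneg _)]
  refine key.trans_eq ?_
  ring

end Implications

/-! ### Evaluation maps into L_p(μ) and L_q(τ), and the resulting domination -/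

section Factorization

variable {𝕜 : Type} [RCLike 𝕜] {X : Type u} [MetricSpace X] {x₀ : X}
  {F : Type v} [NormedAddCommGroup F] [NormedSpace 𝕜 F] {p θ q ν C : ℝ} {T : X → F}

/-- Evaluation of the functions of `B_{X^#}` at a point. -/
noncomputable def LipUnitBall.evalMap (𝕜 : Type) [RCLike 𝕜] (x₀ x : X) :
    C(LipUnitBall x₀, 𝕜) :=
  ⟨fun f => ((f x : ℝ) : 𝕜), RCLike.continuous_ofReal.comp (LipUnitBall.continuous_eval x)⟩

/-- The linear map that sends a vector to its evaluation on `B_{E^*}`. -/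
noncomputable def DualUnitBall.evalLinearMap (𝕜 : Type) [RCLike 𝕜] (E : Type v)
    [NormedAddCommGroup E] [NormedSpace 𝕜 E] : E →ₗ[𝕜] C(DualUnitBall 𝕜 E, 𝕜) where
  toFun a := ⟨fun ξ => ξ a, DualUnitBall.continuous_eval a⟩
  map_add' a b := by
    ext ξ
    simp
  map_smul' c a := by
    ext ξ
    simp

theorem integral_rpow_one_div_rpow {K : Type*} [MeasurableSpace K] (μ : Measure K) {g : K → ℝ}
    (hg : ∀ x, 0 ≤ g x) (hp : 1 ≤ p) :
    ((∫ x, g x ^ p ∂μ) ^ (1 / p)) ^ p = ∫ x, g x ^ p ∂μ := by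
  rw [one_div, Real.rpow_inv_rpow (integral_nonneg fun x => Real.rpow_nonneg (hg x) _)
    (by linarith)]

/-- Evaluation is a Lipschitz `p`-summing map into `L_p(μ)`, with constant `1`. -/
theorem isLipSumming_evalMap_toLp (μ : Measure (LipUnitBall x₀)) [IsProbabilityMeasure μ]
    (hp : 1 ≤ p) [Fact (1 ≤ ENNReal.ofReal p)] :
    (∀ x' x'', ‖ContinuousMap.toLp (ENNReal.ofReal p) μ 𝕜 (LipUnitBall.evalMap 𝕜 x₀ x') -
        ContinuousMap.toLp (ENNReal.ofReal p) μ 𝕜 (LipUnitBall.evalMap 𝕜 x₀ x'')‖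
          = (∫ f, |f x' - f x''| ^ p ∂μ) ^ (1 / p)) ∧
    LipschitzWith 1 (fun x =>
      ContinuousMap.toLp (ENNReal.ofReal p) μ 𝕜 (LipUnitBall.evalMap 𝕜 x₀ x)) ∧
    IsLipSummingConst x₀ p (fun x =>
      ContinuousMap.toLp (ENNReal.ofReal p) μ 𝕜 (LipUnitBall.evalMap 𝕜 x₀ x)) 1 := by
  have hp0 : 0 < p := by linarith
  have hnorm : ∀ x' x'', ‖ContinuousMap.toLp (ENNReal.ofReal p) μ 𝕜 (LipUnitBall.evalMap 𝕜 x₀ x') -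
        ContinuousMap.toLp (ENNReal.ofReal p) μ 𝕜 (LipUnitBall.evalMap 𝕜 x₀ x'')‖
          = (∫ f, |f x' - f x''| ^ p ∂μ) ^ (1 / p) := by
    intro x' x''
    rw [← map_sub, norm_toLp_eq_integral μ hp]
    congr 2
    ext f
    rw [ContinuousMap.sub_apply]
    simp only [LipUnitBall.evalMap, ContinuousMap.coe_mk]
    rw [← RCLike.ofReal_sub, RCLike.norm_ofReal]
  have hcont : ∀ x' x'' : X, Continuous fun f : LipUnitBall x₀ => |f x' - f x''| ^ p := by
    intro x' x''
    exact ((LipUnitBall.continuous_eval x').sub (LipUnitBall.continuous_eval x'')).abs.rpow_const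
      fun _ => Or.inr hp0.le
  refine ⟨hnorm, LipschitzWith.of_dist_le_mul fun x y => ?_, zero_le_one,
    fun m lam x' x'' hlam => ?_⟩
  · rw [dist_eq_norm, hnorm, NNReal.coe_one, one_mul, one_div,
      Real.rpow_inv_le_iff_of_pos (integral_nonneg fun f => by positivity) dist_nonneg hp0]
    have := sum_integral_le_of_forall_sum_le μ (m := 1) (g := fun _ f => |f x - f y| ^ p)
      (fun _ => hcont x y) (M := dist x y ^ p) fun f => by
        simpa using Real.rpow_le_rpow (abs_nonneg _) (f.abs_sub_le_dist x y) hp0.le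
    simpa using this
  · rw [one_mul]
    have hc : ∀ j, Continuous fun f : LipUnitBall x₀ => |lam j| ^ p * |f (x' j) - f (x'' j)| ^ p :=
      fun j => continuous_const.mul (hcont _ _)
    have hW : 0 ≤ lipWeakEllNorm x₀ p lam x' x'' := Real.iSup_nonneg fun f => by positivity
    -- The sum is bounded at every f by the supremum; averaging this over μ is the summing
    -- inequality with constant 1.
    have hM : ∀ f : LipUnitBall x₀, ∑ j, |lam j| ^ p * |f (x' j) - f (x'' j)| ^ p
        ≤ lipWeakEllNorm x₀ p lam x' x'' ^ p := fun f => by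
      rw [← Real.rpow_inv_le_iff_of_pos (Finset.sum_nonneg fun j _ => by positivity) hW hp0,
        ← one_div]
      exact le_ciSup (bddAbove_range_sum_rpow hc (by positivity)) f
    rw [lipEllNorm, one_div,
      Real.rpow_inv_le_iff_of_pos (Finset.sum_nonneg fun j _ => by positivity) hW hp0]
    simp only [dist_eq_norm, hnorm]
    refine le_trans (le_of_eq ?_) (sum_integral_le_of_forall_sum_le μ hc hM)
    refine Finset.sum_congr rfl fun j _ => ?_
    rw [integral_const_mul, integral_rpow_one_div_rpow μ (fun _ => abs_nonneg _) hp]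

/-- Evaluation is a `q`-summing operator into `L_q(τ)`, with constant `1`. -/
theorem exists_isSummingConst_one_norm_eq {E : Type v} [NormedAddCommGroup E] [NormedSpace 𝕜 E]
    (τ : Measure (DualUnitBall 𝕜 E)) [IsProbabilityMeasure τ]
    (hq : 1 ≤ q) [Fact (1 ≤ ENNReal.ofReal q)] :
    ∃ R : E →L[𝕜] Lp 𝕜 (ENNReal.ofReal q) τ,
      (∀ a, ‖R a‖ = (∫ ξ, ‖ξ a‖ ^ q ∂τ) ^ (1 / q)) ∧ IsSummingConst 𝕜 q R 1 := by
  have hq0 : 0 < q := by linarith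
  let R₀ : E →ₗ[𝕜] Lp 𝕜 (ENNReal.ofReal q) τ :=
    (ContinuousMap.toLp (E := 𝕜) (ENNReal.ofReal q) τ 𝕜).toLinearMap ∘ₗ
      DualUnitBall.evalLinearMap 𝕜 E
  have hnorm : ∀ a, ‖R₀ a‖ = (∫ ξ, ‖ξ a‖ ^ q ∂τ) ^ (1 / q) := fun a =>
    norm_toLp_eq_integral τ hq (DualUnitBall.evalLinearMap 𝕜 E a)
  have hcont : ∀ a : E, Continuous fun ξ : DualUnitBall 𝕜 E => ‖ξ a‖ ^ q := fun a =>
    (DualUnitBall.continuous_eval a).norm.rpow_const fun _ => Or.inr hq0.le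
  have hbound : ∀ a, ‖R₀ a‖ ≤ 1 * ‖a‖ := fun a => by
    rw [hnorm, one_mul, one_div,
      Real.rpow_inv_le_iff_of_pos (integral_nonneg fun f => by positivity) (norm_nonneg _) hq0]
    have := sum_integral_le_of_forall_sum_le τ (m := 1) (g := fun _ ξ => ‖ξ a‖ ^ q)
      (fun _ => hcont a) (M := ‖a‖ ^ q) fun ξ => by
        simpa using Real.rpow_le_rpow (norm_nonneg _) (ξ.norm_apply_le a) hq0.le
    simpa using this
  refine ⟨R₀.mkContinuous 1 hbound, hnorm, zero_le_one, fun m a => ?_⟩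
  have hW : 0 ≤ weakEllNorm 𝕜 q a := Real.iSup_nonneg fun ξ => by positivity
  have hM : ∀ ξ : DualUnitBall 𝕜 E, ∑ j, ‖ξ (a j)‖ ^ q ≤ weakEllNorm 𝕜 q a ^ q := fun ξ => by
    rw [← Real.rpow_inv_le_iff_of_pos (Finset.sum_nonneg fun j _ => by positivity) hW hq0,
      ← one_div]
    exact le_ciSup (bddAbove_range_sum_rpow (fun j => hcont (a j)) (by positivity)) ξ
  rw [one_mul, ellNorm, one_div,
    Real.rpow_inv_le_iff_of_pos (Finset.sum_nonneg fun j _ => by positivity) hW hq0]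
  simp only [LinearMap.mkContinuous_apply, hnorm]
  refine le_trans (le_of_eq ?_) (sum_integral_le_of_forall_sum_le τ (fun j => hcont (a j)) hM)
  exact Finset.sum_congr rfl fun j _ => integral_rpow_one_div_rpow τ (fun _ => norm_nonneg _) hq

/-- The constant factor of an interpolated integrand comes out of the integral. -/
theorem integral_delta_rpow {K : Type*} [MeasurableSpace K] (μ : Measure K) {g : K → ℝ} {d : ℝ}
    (hg : ∀ x, 0 ≤ g x) (hd : 0 ≤ d) (hp : 1 ≤ p) (hθ' : θ < 1) :
    (∫ x, (g x ^ (1 - θ) * d ^ θ) ^ (p / (1 - θ)) ∂μ) ^ ((1 - θ) / p)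
      = d ^ θ * ((∫ x, g x ^ p ∂μ) ^ (1 / p)) ^ (1 - θ) := by
  have h : 0 < 1 - θ := by linarith
  have hI : 0 ≤ ∫ x, g x ^ p ∂μ := integral_nonneg fun x => Real.rpow_nonneg (hg x) _
  have hpt : ∀ x, (g x ^ (1 - θ) * d ^ θ) ^ (p / (1 - θ))
      = (d ^ (θ / (1 - θ))) ^ p * g x ^ p := fun x => by
    simpa using mul_rpow_mul_rpow_rpow (p := p) zero_le_one (hg x) hd hθ'
  simp only [hpt, integral_const_mul]
  rw [Real.mul_rpow (by positivity) hI, ← Real.rpow_mul hI, ← Real.rpow_mul hd,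
    ← Real.rpow_mul hd]
  congr 2
  · field_simp
  · ring

/-- Pulling d^θ and ‖b‖^ν out of the integrals leaves exactly the L_p and L_q norms of the
evaluations. The strict C < C' is there because admissibility demands a positive constant and C may
be 0. -/
theorem IsIntegralConst.exists_isAdmissible (h : IsIntegralConst 𝕜 x₀ p θ q ν T C) (hp : 1 ≤ p)
    (hq : 1 ≤ q) (hθ' : θ < 1) (hν' : ν < 1) {C' : ℝ} (hC' : C < C') :
    ∃ (G : Type u) (_ : NormedAddCommGroup G) (_ : NormedSpace 𝕜 G) (_ : CompleteSpace G)
      (H : Type v) (_ : NormedAddCommGroup H) (_ : NormedSpace 𝕜 H) (_ : CompleteSpace H)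
      (S : X → G) (R : StrongDual 𝕜 F →L[𝕜] H), IsAdmissible 𝕜 x₀ p θ q ν T S R C' ∧
        C' * lipSummingNorm x₀ p S ^ (1 - θ) * summingNorm 𝕜 q R ^ (1 - ν) ≤ C' := by
  obtain ⟨hC, μ, τ, hμ, -, hτ, -, hdom⟩ := h
  have : Fact (1 ≤ ENNReal.ofReal p) := ⟨by simpa using hp⟩
  have : Fact (1 ≤ ENNReal.ofReal q) := ⟨by simpa using hq⟩
  obtain ⟨hSn, hSl, hS1⟩ := isLipSumming_evalMap_toLp (𝕜 := 𝕜) μ hp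
  obtain ⟨R, hRn, hR1⟩ := exists_isSummingConst_one_norm_eq τ hq
  have hS : IsLipSumming x₀ p fun x =>
      ContinuousMap.toLp (ENNReal.ofReal p) μ 𝕜 (LipUnitBall.evalMap 𝕜 x₀ x) :=
    ⟨⟨1, hSl⟩, 1, hS1⟩
  refine ⟨Lp 𝕜 (ENNReal.ofReal p) μ, inferInstance, inferInstance, inferInstance,
    Lp 𝕜 (ENNReal.ofReal q) τ, inferInstance, inferInstance, inferInstance, _, R,
    ⟨hS, ⟨1, hR1⟩, hC.trans_lt hC', fun x' x'' b => ?_⟩, ?_⟩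
  · refine (hdom x' x'' b).trans ?_
    rw [integral_delta_rpow μ (fun _ => abs_nonneg _) dist_nonneg hp hθ',
      integral_delta_rpow τ (fun _ => norm_nonneg _) (norm_nonneg b) hq hν', ← hSn, ← hRn]
    calc C * (dist x' x'' ^ θ * _ ^ (1 - θ)) * (‖b‖ ^ ν * ‖R b‖ ^ (1 - ν))
        ≤ C' * (dist x' x'' ^ θ * _ ^ (1 - θ)) * (‖b‖ ^ ν * ‖R b‖ ^ (1 - ν)) := by gcongr
      _ = _ := by ring
  · have hS0 := hS.isLipSummingConst_lipSummingNorm.1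
    have hR0 := (show IsSumming 𝕜 q R from ⟨1, hR1⟩).isSummingConst_summingNorm.1
    have h1 := Real.rpow_le_one hS0 (csInf_le ⟨0, fun _ h => h.1⟩ hS1) (by linarith : 0 ≤ 1 - θ)
    have h2 := Real.rpow_le_one hR0 (csInf_le ⟨0, fun _ h => h.1⟩ hR1) (by linarith : 0 ≤ 1 - ν)
    have h3 := mul_le_one₀ h1 (Real.rpow_nonneg hR0 _) h2
    rw [mul_assoc]
    exact mul_le_of_le_one_right (hC.trans hC'.le) h3

end Factorization

/-! ### The equivalence and the equality of the constants -/

theorem mainTheorem1 {𝕜 : Type} [RCLike 𝕜] {X : Type*} [MetricSpace X] (x₀ : X)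
    {F : Type*} [NormedAddCommGroup F] [NormedSpace 𝕜 F] [CompleteSpace F]
    (p θ q ν r : ℝ) (hp : 1 ≤ p) (hq : 1 ≤ q) (hθ : 0 ≤ θ) (hθ' : θ < 1) (hν : 0 ≤ ν) (hν' : ν < 1)
    (hr : 1 ≤ r) (hpqr : 1 / r + (1 - θ) / p + (1 - ν) / q = 1)
    (T : X → F) (hT : ∃ K, LipschitzWith K T) :
    List.TFAE
      [IsLipDominated 𝕜 x₀ p θ q ν T,
       ∃ C, IsIntegralConst 𝕜 x₀ p θ q ν T C,
       ∃ C, IsMixedSummingConst 𝕜 x₀ p θ q ν (Real.conjExponent r) T C] ∧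
    (IsLipDominated 𝕜 x₀ p θ q ν T →
      IsGLB {C | IsIntegralConst 𝕜 x₀ p θ q ν T C} (lipDominatedNorm 𝕜 x₀ p θ q ν T) ∧
      IsGLB {C | IsMixedSummingConst 𝕜 x₀ p θ q ν (Real.conjExponent r) T C}
        (lipDominatedNorm 𝕜 x₀ p θ q ν T)) := by
  have hs := holderTriple_conjExponent hp hq hθ' hν' hr hpqr
  have h32 : ∀ C, IsMixedSummingConst 𝕜 x₀ p θ q ν (Real.conjExponent r) T C →
      IsIntegralConst 𝕜 x₀ p θ q ν T C := fun C h => h.isIntegralConst hp hq hθ' hν hν' hs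
  have hval : ∀ D ∈ dominationValues 𝕜 x₀ p θ q ν T,
      IsMixedSummingConst 𝕜 x₀ p θ q ν (Real.conjExponent r) T D := by
    rintro _ ⟨G, _, _, _, H, _, _, _, S, R, C, h, rfl⟩
    exact h.isMixedSummingConst hp hq hθ' hν' hs
  have hle : ∀ C, IsIntegralConst 𝕜 x₀ p θ q ν T C → lipDominatedNorm 𝕜 x₀ p θ q ν T ≤ C := by
    intro C h
    -- Every C' > C bounds a domination value, which suffices for an infimum.
    refine le_of_forall_gt_imp_ge_of_dense fun C' hC' => ?_
    obtain ⟨G, i₁, i₂, i₃, H, i₄, i₅, i₆, S, R, hadm, hD⟩ :=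
      h.exists_isAdmissible hp hq hθ' hν' hC'
    exact (csInf_le ⟨0, fun D hD => (hval D hD).1⟩
      ⟨G, i₁, i₂, i₃, H, i₄, i₅, i₆, S, R, C', hadm, rfl⟩).trans hD
  refine ⟨?_, ?_⟩
  · tfae_have 1 → 3 := by
      rintro ⟨-, G, _, _, _, H, _, _, _, S, R, C, h⟩
      exact ⟨_, h.isMixedSummingConst hp hq hθ' hν' hs⟩
    tfae_have 3 → 2 := fun ⟨C, h⟩ => ⟨C, h32 C h⟩
    tfae_have 2 → 1 := by
      rintro ⟨C, h⟩
      obtain ⟨G, i₁, i₂, i₃, H, i₄, i₅, i₆, S, R, hadm, -⟩ :=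
        h.exists_isAdmissible hp hq hθ' hν' (lt_add_one C)
      exact ⟨hT, G, i₁, i₂, i₃, H, i₄, i₅, i₆, S, R, C + 1, hadm⟩
    tfae_finish
  · rintro ⟨-, G, i₁, i₂, i₃, H, i₄, i₅, i₆, S, R, C, h⟩
    have hne : (dominationValues 𝕜 x₀ p θ q ν T).Nonempty :=
      ⟨_, G, i₁, i₂, i₃, H, i₄, i₅, i₆, S, R, C, h, rfl⟩
    -- Domination values are constants for (3), and these are constants for (2). A lower bound of
    -- either set of constants thus bounds the domination values from below, while `hle` gives the
    -- converse estimate.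
    exact ⟨⟨fun C hC => hle C hC, fun L hL => le_csInf hne fun D hD => hL (h32 D (hval D hD))⟩,
      ⟨fun C hC => hle C (h32 C hC), fun L hL => le_csInf hne fun D hD => hL (hval D hD)⟩⟩
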